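/- All graphs are simple, and may be infinite. A graph is infinitely edge-connected if it has at least two vertices and remains connected after the deletion of any finite set of edges. Two $x$–$y$ paths are independent if they have no vertices in common other than $x$ and $y$. A $\Pi$-graph is an infinitely edge-connected graph that does not contain infinitely many pairwise independent paths between any two distinct vertices. A graph $H$ is a tight minor of a graph $G$ if there are pairwise disjoint, non-empty, finite vertex sets $B_a \subseteq V(G)$, one for each vertex $a$ of $H$, such that each $B_a$ induces a connected subgraph of $G$ and, for every edge $ab$ of $H$, there is an edge of $G$ between $B_a$ and $B_b$. Two graphs are tightly minor-equivalent if they are tight minors of each other. A $\Pi$-graph is tightly typical if it is a tight minor of every $\Pi$-graph. The Farey graph is the graph on $\mathbb{Q}\cup\{\infty\}$ in which $a/b$ and $c/d$, written in lowest terms (with $\infty = 1/0$), are adjacent if and only if $\det\begin{pmatrix} a & c\\ b & d\end{pmatrix}=\pm 1$. **Theorem 3.2.** Up to tight minor-equivalence, the Farey graph is the unique tightly typical $\Pi$-graph: the Farey graph is a tightly typical $\Pi$-graph, and every tightly typical $\Pi$-graph is tightly minor-equivalent to the Farey graph. -/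

import Mathlib

universe u v w

namespace SimpleGraph

/-- A graph is infinitely edge-connected if it has at least two vertices and is `k`-edge-connected
for every natural number `k`, that is, it stays connected after the deletion of any finite set of
edges. -/
def IsInfinitelyEdgeConnected {V : Type v} (G : SimpleGraph V) : Prop :=
  Nontrivial V ∧ ∀ k : ℕ, G.IsEdgeConnected k

/-- Two `x`–`y` paths are independent if they have no vertices in common other than the
ends `x` and `y`. -/
def IndependentPaths {V : Type v} {G : SimpleGraph V} {x y : V} (p q : G.Path x y) : Prop :=
  ∀ z ∈ (p : G.Walk x y).support, z ∈ (q : G.Walk x y).support → z = x ∨ z = y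

/-- A Π-graph is an infinitely edge-connected graph that does not contain infinitely many
(pairwise) independent paths between any two (distinct) vertices. -/
def IsPiGraph {V : Type v} (G : SimpleGraph V) : Prop :=
  G.IsInfinitelyEdgeConnected ∧
    ∀ x y : V, x ≠ y → ¬ ∃ P : Set (G.Path x y), P.Infinite ∧ P.Pairwise IndependentPaths

/-- The sets `B a`, one for every vertex `a` of `H`, are the branch sets of an `H` minor in `G`:
they are non-empty, connected and pairwise disjoint, and for every edge `ab` of `H`
there is an edge of `G` between `B a` and `B b`.
(`SimpleGraph.Connected` includes non-emptiness.) -/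
def AreBranchSets {W : Type w} {V : Type v} (H : SimpleGraph W) (G : SimpleGraph V)
    (B : W → Set V) : Prop :=
  (∀ a, (G.induce (B a)).Connected) ∧
  (∀ a b, a ≠ b → Disjoint (B a) (B b)) ∧
  (∀ a b, H.Adj a b → ∃ x ∈ B a, ∃ y ∈ B b, G.Adj x y)

/-- `H` is a tight minor of `G`: it is a minor of `G` with finite branch sets. -/
def IsTightMinor {W : Type w} {V : Type v} (H : SimpleGraph W) (G : SimpleGraph V) : Prop :=
  ∃ B : W → Set V, AreBranchSets H G B ∧ ∀ a, (B a).Finite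

/-- Two graphs are tightly minor-equivalent if they are tight minors of each other. -/
def TightlyMinorEquivalent {W : Type w} {V : Type v} (H : SimpleGraph W) (G : SimpleGraph V) :
    Prop :=
  IsTightMinor H G ∧ IsTightMinor G H

/-- `G` is a tightly typical Π-graph: it is a Π-graph that occurs as a tight minor in every
Π-graph. The universe `u₁` in which these Π-graphs live is arbitrary. -/
def IsTightlyTypical.{u₁, v₁} {V : Type v₁} (G : SimpleGraph V) : Prop :=
  G.IsPiGraph ∧ ∀ (W : Type u₁) (H : SimpleGraph W), H.IsPiGraph → IsTightMinor G H

end SimpleGraph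

/-- The numerator of an element of `ℚ ∪ {∞}` in lowest terms, where `∞ = 1/0`. -/
def fareyNum : OnePoint ℚ → ℤ
  | none => 1
  | some q => q.num

/-- The (non-negative) denominator of an element of `ℚ ∪ {∞}` in lowest terms,
where `∞ = 1/0`. -/
def fareyDen : OnePoint ℚ → ℤ
  | none => 0
  | some q => q.den

/-- The Farey graph: the graph on `ℚ ∪ {∞}` in which `a/b` and `c/d`, in lowest terms, form an edge
if and only if the matrix with columns `(a, b)` and `(c, d)` has determinant `1` or `-1`. -/
def fareyGraph : SimpleGraph (OnePoint ℚ) where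
  Adj x y := !![fareyNum x, fareyNum y; fareyDen x, fareyDen y].det = 1 ∨
    !![fareyNum x, fareyNum y; fareyDen x, fareyDen y].det = -1
  symm := ⟨fun x y h => by
    simp only [Matrix.det_fin_two_of] at h ⊢
    rcases h with h | h
    · right; linarith
    · left; linarith⟩
  loopless := ⟨fun x h => by
    simp only [Matrix.det_fin_two_of] at h
    rcases h with h | h <;> linarith⟩

/-! The uniqueness half is formal: once the Farey graph is known to be a Π-graph and a tight minor
of every Π-graph, a tightly typical `G` is a tight minor of it by definition, and conversely.

To find the Farey graph in a Π-graph, start from an edge and keep inserting a new finite branch set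
between the two ends of an edge, as mediants are inserted in the Farey graph. The invariant is
`IsCell`: finite connected ends `A`, `B` that no finite set of edges separates within `A ∪ D ∪ B`.
The absence of infinitely many independent paths yields a finite vertex separator in `D`; a finite
connected set containing its relevant part becomes the new branch set and leaves two cells with
disjoint reserves (`IsCell.exists_refinement`). Iterating along the subtractive Euclidean algorithm
gives branch sets for the vectors between `(1, 0)` and `(0, 1)`, half a Farey graph; merging its two
ends into `∞` gives the whole one.

That the Farey graph is a Π-graph rests on determinants. Detours through mediants have unbounded
height, so they escape any finite edge set. Conversely, every edge separates its two sides
(`fareySide`), so three neighbours of `x` meet all indirect `x`–`y` paths. -/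

namespace SimpleGraph

/-! ### Cells and their refinement -/

section Linked

variable {V : Type v} {G : SimpleGraph V}

/-- If there are only finitely many pairwise independent `x`–`y` paths, then some finite set
meets all `x`–`y` paths that have at least one inner vertex and all inner vertices in `D`. -/
theorem exists_finite_separator {x y : V} {D : Set V} (hxy : x ≠ y) (hx : x ∉ D) (hy : y ∉ D)
    (h : ¬ ∃ P : Set (G.Path x y), P.Infinite ∧ P.Pairwise IndependentPaths) :
    ∃ S : Set V, S.Finite ∧ ∀ t ∈ D, ∀ p : G.Walk x t,
      (∀ z ∈ p.support, z = x ∨ (z ∈ D ∧ z ∉ S)) → ¬ G.Adj t y := by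
  classical
  by_contra! hS
  apply h
  have : Std.Symm (fun p q : G.Path x y => ∀ z ∈ p.1.support, z ∈ q.1.support → z ∉ D) :=
    ⟨fun p q h z hz hz' => h z hz' hz⟩
  -- Greedy choice: the vertices of the earlier paths form a finite set, which fails to separate, so
  -- a further path avoids them inside `D`. Requiring a vertex in `D` excludes the direct edge and
  -- later makes the sequence injective.
  obtain ⟨f, hf, hr⟩ := exists_seq_of_forall_finset_exists'
    (fun p : G.Path x y => (∀ z ∈ p.1.support, z = x ∨ z = y ∨ z ∈ D) ∧
      ∃ z ∈ p.1.support, z ∈ D)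
    (fun p q => ∀ z ∈ p.1.support, z ∈ q.1.support → z ∉ D) (by
      intro s _
      obtain ⟨t, ht, p, hp, hty⟩ := hS {z | ∃ q ∈ s, z ∈ q.1.support} (by
        refine Set.Finite.subset (s := ⋃ q ∈ s, {z | z ∈ q.1.support}) ?_ ?_
        · exact s.finite_toSet.biUnion fun q _ => q.1.support.finite_toSet
        · rintro z ⟨q, hq, hz⟩
          exact Set.mem_biUnion hq hz)
      have hb : ∀ z ∈ p.bypass.support, z = x ∨ (z ∈ D ∧ z ∉ {z | ∃ q ∈ s, z ∈ q.1.support}) :=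
        fun z hz => hp z (p.support_bypass_subset_support hz)
      have hyp : y ∉ p.bypass.support := by
        intro hmem
        rcases hb y hmem with h | h
        · exact hxy h.symm
        · exact hy h.1
      refine ⟨⟨p.bypass.concat hty, p.bypass_isPath.concat hyp hty⟩, ⟨?_, t, ?_, ht⟩, ?_⟩
      · intro z hz
        simp only [Walk.support_concat, List.mem_append, List.mem_singleton] at hz
        rcases hz with hz | hz
        · rcases hb z hz with h | h
          · exact Or.inl h
          · exact Or.inr (Or.inr h.1)
        · exact Or.inr (Or.inl hz)
      · simp [Walk.support_concat]
      · intro q hq z hzq hz hzD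
        simp only [Walk.support_concat, List.mem_append, List.mem_singleton] at hz
        rcases hz with hz | rfl
        · rcases hb z hz with rfl | h
          · exact hx hzD
          · exact h.2 ⟨q, hq, hzq⟩
        · exact hy hzD)
  have hinj : Function.Injective f := by
    intro m n hmn
    by_contra hne
    obtain ⟨z, hz, hzD⟩ := (hf m).2
    exact hr hne z hz (hmn ▸ hz) hzD
  refine ⟨Set.range f, Set.infinite_range_of_injective hinj, ?_⟩
  rintro _ ⟨m, rfl⟩ _ ⟨n, rfl⟩ hne z hz hz'
  have hmn : m ≠ n := fun h => hne (h ▸ rfl)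
  rcases (hf m).1 z hz with h | h | h
  · exact Or.inl h
  · exact Or.inr h
  · exact absurd h (hr hmn z hz hz')

theorem connected_induce_image {s : Set V} {t : Set s} (h : ((G.induce s).induce t).Connected) :
    (G.induce (Subtype.val '' t)).Connected := by
  let e : (G.induce s).induce t ≃g G.induce (Subtype.val '' t) :=
    { toEquiv := Equiv.Set.image _ t Subtype.val_injective
      map_rel_iff' := Iff.rfl }
  exact e.connected_iff.1 h

/-- In a connected induced subgraph, a finite non-empty vertex set extends to a finite connected
one. -/
theorem exists_finite_connected_superset {K S : Set V} (hK : (G.induce K).Preconnected)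
    (hSK : S ⊆ K) (hS : S.Finite) (hne : S.Nonempty) :
    ∃ M : Set V, S ⊆ M ∧ M ⊆ K ∧ M.Finite ∧ (G.induce M).Connected := by
  have hfin : (Subtype.val ⁻¹' S : Set K).Finite := hS.preimage Subtype.val_injective.injOn
  obtain ⟨z, hz⟩ := hne
  obtain ⟨t, ht, hconn⟩ := extend_finset_to_connected hK (t := hfin.toFinset)
    ⟨⟨z, hSK hz⟩, by simpa using hz⟩
  refine ⟨Subtype.val '' (t : Set K), ?_, ?_, t.finite_toSet.image _, connected_induce_image hconn⟩
  · intro s hs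
    exact ⟨⟨s, hSK hs⟩, ht (by simpa using hs), rfl⟩
  · rintro _ ⟨s, _, rfl⟩
    exact s.2

/-- The edges of `G[Y]` that leave `X`, as ordered pairs. -/
def leavingEdges (G : SimpleGraph V) (Y X : Set V) : Set (V × V) :=
  {e | G.Adj e.1 e.2 ∧ e.1 ∈ X ∧ e.2 ∉ X ∧ e.1 ∈ Y ∧ e.2 ∈ Y}

/-- No finite set of edges separates `A` from `B` in `G[A ∪ D ∪ B]`. -/
def InfinitelyLinked (G : SimpleGraph V) (A B D : Set V) : Prop :=
  ∀ X : Set V, A ⊆ X → Disjoint X B → (G.leavingEdges (A ∪ D ∪ B) X).Infinite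

/-- The complement of a cut has the same edges, reversed. -/
theorem InfinitelyLinked.symm {A B D : Set V} (h : G.InfinitelyLinked A B D) :
    G.InfinitelyLinked B A D := by
  intro X hX hXA
  have := h Xᶜ (fun _ ha => Set.disjoint_right.1 hXA ha) (Set.disjoint_left.2 fun _ h h' => h (hX h'))
  refine (this.image Prod.swap_injective.injOn).mono ?_
  rintro _ ⟨⟨a, b⟩, ⟨h1, h2, h3, h4, h5⟩, rfl⟩
  refine ⟨h1.symm, by simpa using h3, h2, ?_, ?_⟩ <;> simp_all only [Set.mem_union] <;> tauto

/-- `A` and `B` are the ends of an edge of a partially constructed minor; `D` is the part of the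
graph that is reserved for refining this edge. -/
structure IsCell (G : SimpleGraph V) (A B D : Set V) : Prop where
  finite_left : A.Finite
  finite_right : B.Finite
  connected_left : (G.induce A).Connected
  connected_right : (G.induce B).Connected
  disjoint : Disjoint A B
  disjoint_left : Disjoint A D
  disjoint_right : Disjoint B D
  adj : ∃ x ∈ A, ∃ y ∈ B, G.Adj x y
  linked : G.InfinitelyLinked A B D

theorem IsCell.symm {A B D : Set V} (h : G.IsCell A B D) : G.IsCell B A D where
  finite_left := h.finite_right
  finite_right := h.finite_left
  connected_left := h.connected_right
  connected_right := h.connected_left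
  disjoint := h.disjoint.symm
  disjoint_left := h.disjoint_right
  disjoint_right := h.disjoint_left
  adj := let ⟨x, hx, y, hy, hxy⟩ := h.adj; ⟨y, hy, x, hx, hxy.symm⟩
  linked := h.linked.symm

/-- Some finite set separates `A` from `B` in `G[A ∪ D ∪ B]` up to direct edges; `T` is the
side of `A`. -/
theorem exists_finite_separation {A B D : Set V} (hA : A.Finite) (hB : B.Finite)
    (hAB : Disjoint A B) (hAD : Disjoint A D) (hBD : Disjoint B D)
    (hG : ∀ x y : V, x ≠ y → ¬ ∃ P : Set (G.Path x y), P.Infinite ∧ P.Pairwise IndependentPaths) :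
    ∃ S T : Set V, S.Finite ∧
      (∀ u ∈ A ∪ T, ∀ v ∈ D, v ∉ S → G.Adj u v → v ∈ T) ∧
      ∀ t ∈ T, ∀ b ∈ B, ¬ G.Adj t b := by
  have key : ∀ x y : V, ∃ S : Set V, x ∈ A → y ∈ B → S.Finite ∧ ∀ t ∈ D, ∀ p : G.Walk x t,
      (∀ z ∈ p.support, z = x ∨ (z ∈ D ∧ z ∉ S)) → ¬ G.Adj t y := by
    intro x y
    by_cases hx : x ∈ A
    · by_cases hy : y ∈ B
      · have hne : x ≠ y := fun h => Set.disjoint_left.1 hAB hx (h ▸ hy)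
        obtain ⟨S, hS⟩ := exists_finite_separator hne (Set.disjoint_left.1 hAD hx)
          (Set.disjoint_left.1 hBD hy) (hG x y hne)
        exact ⟨S, fun _ _ => hS⟩
      · exact ⟨∅, fun _ h => absurd h hy⟩
    · exact ⟨∅, fun h => absurd h hx⟩
  choose S hS using key
  set S' : Set V := ⋃ x ∈ A, ⋃ y ∈ B, S x y
  have hmem : ∀ x ∈ A, ∀ y ∈ B, ∀ z, z ∉ S' → z ∉ S x y := by
    intro x hx y hy z hz hz'
    exact hz (Set.mem_biUnion hx (Set.mem_biUnion hy hz'))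
  -- `T` consists of the vertices reachable from `A` through `D \ S'`.
  refine ⟨S', {t | t ∈ D \ S' ∧ ∃ x ∈ A, ∃ p : G.Walk x t,
    ∀ z ∈ p.support, z = x ∨ (z ∈ D ∧ z ∉ S')}, ?_, ?_, ?_⟩
  · exact hA.biUnion fun x hx => hB.biUnion fun y hy => (hS x y hx hy).1
  · rintro u (hu | ⟨_, x, hx, p, hp⟩) v hv hvS huv
    · refine ⟨⟨hv, hvS⟩, u, hu, huv.toWalk, fun z hz => ?_⟩
      simp only [Walk.support_cons, Walk.support_nil, List.mem_cons, List.not_mem_nil, or_false]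
        at hz
      rcases hz with rfl | rfl
      · exact Or.inl rfl
      · exact Or.inr ⟨hv, hvS⟩
    · refine ⟨⟨hv, hvS⟩, x, hx, p.concat huv, fun z hz => ?_⟩
      simp only [Walk.support_concat, List.mem_append, List.mem_singleton] at hz
      rcases hz with hz | rfl
      · exact hp z hz
      · exact Or.inr ⟨hv, hvS⟩
  · rintro t ⟨ht, x, hx, p, hp⟩ y hy
    exact (hS x y hx hy).2 t ht.1 p fun z hz => (hp z hz).imp id fun h => ⟨h.1, hmem x hx y hy z h.2⟩

/-- Some connected part of `D` suffices to keep `A` and `B` infinitely linked. -/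
theorem InfinitelyLinked.exists_connected {A B D S T : Set V} (hA : A.Finite) (hB : B.Finite)
    (hAB : Disjoint A B) (hBD : Disjoint B D) (hS : S.Finite)
    (hT : ∀ u ∈ A ∪ T, ∀ v ∈ D, v ∉ S → G.Adj u v → v ∈ T)
    (hTB : ∀ t ∈ T, ∀ b ∈ B, ¬ G.Adj t b) (h : G.InfinitelyLinked A B D) :
    ∃ K ⊆ D, (G.induce K).Connected ∧ G.InfinitelyLinked A B K := by
  classical
  by_contra! hK
  have hfail : ∀ C : (G.induce D).ConnectedComponent, ∃ X : Set V, A ⊆ X ∧ Disjoint X B ∧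
      (G.leavingEdges (A ∪ Subtype.val '' C.supp ∪ B) X).Finite := by
    intro C
    have := hK (Subtype.val '' C.supp) (by rintro _ ⟨z, _, rfl⟩; exact z.2)
      (connected_induce_image C.connected_toSimpleGraph)
    unfold InfinitelyLinked at this
    push Not at this
    exact this
  choose X hAX hXB hX using hfail
  let c : D → (G.induce D).ConnectedComponent := (G.induce D).connectedComponentMk
  have hcs : (c '' (Subtype.val ⁻¹' S)).Finite :=
    (hS.preimage Subtype.val_injective.injOn).image c
  set cs := c '' (Subtype.val ⁻¹' S)
  have hc : ∀ u v : D, G.Adj u v → c u = c v := fun u v huv =>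
    ConnectedComponent.sound (Adj.reachable (G := G.induce D) huv)
  have hSc : ∀ v : D, c v ∉ cs → v.1 ∉ S := fun v hv hvS => hv ⟨v, hvS, rfl⟩
  have hsupp : ∀ v : D, v.1 ∈ Subtype.val '' (c v).supp := fun v => ⟨v, rfl, rfl⟩
  -- If every component of `G[D]` has a finite cut, these glue to one for `D`: the finitely many
  -- components meeting `S` keep their own cut, and all others are cut along `T`, which no edge
  -- leaves there.
  let Z : Set V := A ∪ {v | ∃ hv : v ∈ D, (c ⟨v, hv⟩ ∈ cs ∧ v ∈ X (c ⟨v, hv⟩)) ∨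
    (c ⟨v, hv⟩ ∉ cs ∧ v ∈ T)}
  refine h Z Set.subset_union_left ?_ ?_
  · refine Set.disjoint_left.2 ?_
    rintro v (hv | ⟨hv, _⟩) hvB
    · exact Set.disjoint_left.1 hAB hv hvB
    · exact Set.disjoint_left.1 hBD hvB hv
  · refine Set.Finite.subset (s := A ×ˢ B ∪
      ⋃ C ∈ cs, G.leavingEdges (A ∪ Subtype.val '' C.supp ∪ B) (X C))
      ((hA.prod hB).union (hcs.biUnion fun C _ => hX C)) ?_
    rintro ⟨u, v⟩ ⟨huv, hu, hv, -, hvY⟩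
    simp only at huv hu hv hvY
    have hvA : v ∉ A := fun h => hv (Or.inl h)
    have hvD : ∀ h : v ∈ D, ¬ ((c ⟨v, h⟩ ∈ cs ∧ v ∈ X (c ⟨v, h⟩)) ∨ (c ⟨v, h⟩ ∉ cs ∧ v ∈ T)) :=
      fun h h' => hv (Or.inr ⟨h, h'⟩)
    rcases hu with hu | ⟨huD, hu⟩ <;> rcases hvY with (h' | hvD') | hvB
    · exact absurd h' hvA
    · by_cases hvc : c ⟨v, hvD'⟩ ∈ cs
      · refine Or.inr (Set.mem_biUnion hvc ⟨huv, hAX _ hu, ?_, Or.inl (Or.inl hu),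
          Or.inl (Or.inr (hsupp ⟨v, hvD'⟩))⟩)
        exact fun h' => hvD hvD' (Or.inl ⟨hvc, h'⟩)
      · exact absurd (Or.inr ⟨hvc, hT u (Or.inl hu) v hvD' (hSc _ hvc) huv⟩) (hvD hvD')
    · exact Or.inl ⟨hu, hvB⟩
    · exact absurd h' hvA
    · have hcuv : c ⟨u, huD⟩ = c ⟨v, hvD'⟩ := hc _ _ huv
      rcases hu with ⟨huc, hu⟩ | ⟨huc, hu⟩
      · refine Or.inr (Set.mem_biUnion huc ⟨huv, hu, ?_, Or.inl (Or.inr (hsupp ⟨u, huD⟩)),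
          Or.inl (Or.inr (hcuv ▸ hsupp ⟨v, hvD'⟩))⟩)
        exact fun h' => hvD hvD' (Or.inl ⟨hcuv ▸ huc, hcuv ▸ h'⟩)
      · rw [hcuv] at huc
        exact absurd (Or.inr ⟨huc, hT u (Or.inr hu) v hvD' (hSc _ huc) huv⟩) (hvD hvD')
    · rcases hu with ⟨huc, hu⟩ | ⟨huc, hu⟩
      · exact Or.inr (Set.mem_biUnion huc ⟨huv, hu, fun h' => Set.disjoint_left.1 (hXB _) h' hvB,
          Or.inl (Or.inr (hsupp ⟨u, huD⟩)), Or.inr hvB⟩)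
      · exact absurd huv (hTB u hu v hvB)

/-- If `A` and `B` are infinitely linked through `K`, then `A` has a neighbour in `K`. -/
theorem InfinitelyLinked.exists_adj {A B K : Set V} (hA : A.Finite) (hB : B.Finite)
    (hAB : Disjoint A B) (h : G.InfinitelyLinked A B K) : ∃ a ∈ A, ∃ v ∈ K, G.Adj a v := by
  by_contra! hno
  refine h A subset_rfl hAB ((hA.prod hB).subset ?_)
  rintro ⟨u, v⟩ ⟨huv, hu, hv, -, (h' | h') | h'⟩
  · exact absurd h' hv
  · exact absurd huv (hno u hu v h')
  · exact ⟨hu, h'⟩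

/-- Contracting a subset `M` of `K` keeps `A` infinitely linked to `M` through `E`, if `E` contains
all vertices of `K \ M` on the `A`-side of `M`. -/
theorem InfinitelyLinked.restrict {A B K M E : Set V} (hA : A.Finite) (hB : B.Finite)
    (hBK : Disjoint B K) (hEK : E ⊆ K)
    (hE : ∀ u ∈ A ∪ E, ∀ v ∈ K, v ∉ M → G.Adj u v → v ∈ E)
    (hEB : ∀ u ∈ E, ∀ b ∈ B, ¬ G.Adj u b) (hAB : Disjoint A B)
    (h : G.InfinitelyLinked A B K) : G.InfinitelyLinked A M E := by
  intro X hAX hXM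
  -- Apart from the finitely many `A`–`B` edges, every edge leaving `A ∪ (X ∩ E)` also leaves `X` in
  -- the smaller graph.
  have := h (A ∪ (X ∩ E)) Set.subset_union_left (Set.disjoint_left.2 (by
    rintro v (hv | ⟨_, hv⟩) hvB
    · exact Set.disjoint_left.1 hAB hv hvB
    · exact Set.disjoint_left.1 hBK hvB (hEK hv)))
  refine (this.sdiff (hA.prod hB)).mono ?_
  rintro ⟨u, v⟩ ⟨⟨huv, hu, hv, -, hvY⟩, hnot⟩
  simp only [Set.mem_union, Set.mem_inter_iff, not_or, not_and, Set.mem_prod] at huv hu hv hvY hnot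
  have huX : u ∈ X := hu.elim (fun h => hAX h) And.left
  have huAE : u ∈ A ∪ E := hu.imp id And.right
  have huY : u ∈ A ∪ E ∪ M := Or.inl huAE
  rcases hvY with (h' | hvK) | hvB
  · exact absurd h' hv.1
  · by_cases hvM : v ∈ M
    · exact ⟨huv, huX, Set.disjoint_right.1 hXM hvM, huY, Or.inr hvM⟩
    · have hvE := hE u huAE v hvK hvM huv
      exact ⟨huv, huX, fun h => hv.2 h hvE, huY, Or.inl (Or.inr hvE)⟩
  · rcases hu with hu | hu
    · exact absurd hvB (hnot hu)
    · exact absurd huv (hEB u hu.2 v hvB)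

/-- `M` swallows the part of the separator `S` in a linking connected set `K`, together with a
neighbour of each end. The rest of `K` then splits into the `A`-side `T` and its complement, which
serve as the two reserves. -/
theorem IsCell.exists_refinement {A B D : Set V} (h : G.IsCell A B D)
    (hG : ∀ x y : V, x ≠ y → ¬ ∃ P : Set (G.Path x y), P.Infinite ∧ P.Pairwise IndependentPaths) :
    ∃ M D₁ D₂ : Set V, G.IsCell A M D₁ ∧ G.IsCell M B D₂ ∧ M ⊆ D ∧ D₁ ⊆ D ∧ D₂ ⊆ D ∧
      Disjoint D₁ D₂ := by
  obtain ⟨S, T, hS, hT, hTB⟩ := exists_finite_separation h.finite_left h.finite_right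
    h.disjoint h.disjoint_left h.disjoint_right hG
  obtain ⟨K, hKD, hK, hKl⟩ := h.linked.exists_connected h.finite_left h.finite_right
    h.disjoint h.disjoint_right hS hT hTB
  obtain ⟨a, ha, v, hv, hav⟩ := hKl.exists_adj h.finite_left h.finite_right h.disjoint
  obtain ⟨b, hb, w, hw, hbw⟩ := (hKl.symm).exists_adj h.finite_right h.finite_left
    h.disjoint.symm
  obtain ⟨M, hM, hMK, hMfin, hMconn⟩ := exists_finite_connected_superset hK.preconnected
    (S := (S ∩ K) ∪ {v, w})
    (Set.union_subset Set.inter_subset_right (by rintro z (rfl | rfl) <;> assumption))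
    ((hS.subset Set.inter_subset_left).union (Set.toFinite _)) ⟨v, by simp⟩
  have hvM : v ∈ M := hM (by simp)
  have hwM : w ∈ M := hM (by simp)
  have hSM : ∀ z ∈ K, z ∉ M → z ∉ S := fun z hz hzM hzS => hzM (hM (Or.inl ⟨hzS, hz⟩))
  have hMA : Disjoint A M := h.disjoint_left.mono_right (hMK.trans hKD)
  have hMB : Disjoint B M := h.disjoint_right.mono_right (hMK.trans hKD)
  have hBK : Disjoint B K := h.disjoint_right.mono_right hKD
  have hAK : Disjoint A K := h.disjoint_left.mono_right hKD
  have h₁ : (K ∩ T) \ M ⊆ K := fun z hz => hz.1.1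
  have h₂ : (K \ T) \ M ⊆ K := fun z hz => hz.1.1
  refine ⟨M, (K ∩ T) \ M, (K \ T) \ M, ?_, IsCell.symm ?_, hMK.trans hKD, h₁.trans hKD,
    h₂.trans hKD, Set.disjoint_left.2 fun z hz hz' => hz'.1.2 hz.1.2⟩
  · refine ⟨h.finite_left, hMfin, h.connected_left, hMconn, hMA, hAK.mono_right h₁,
      Set.disjoint_sdiff_right, ⟨a, ha, v, hvM, hav⟩, ?_⟩
    refine hKl.restrict h.finite_left h.finite_right hBK h₁ ?_ ?_ h.disjoint
    · rintro u hu z hz hzM huz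
      exact ⟨⟨hz, hT u (hu.imp id fun h => h.1.2) z (hKD hz) (hSM z hz hzM) huz⟩, hzM⟩
    · exact fun u hu => hTB u hu.1.2
  · refine ⟨h.finite_right, hMfin, h.connected_right, hMconn, hMB, hBK.mono_right h₂,
      Set.disjoint_sdiff_right, ⟨b, hb, w, hwM, hbw⟩, ?_⟩
    refine (hKl.symm).restrict h.finite_right h.finite_left hAK h₂ ?_ ?_ h.disjoint.symm
    · rintro u (hu | hu) z hz hzM huz
      · exact ⟨⟨hz, fun hzT => hTB z hzT u hu huz.symm⟩, hzM⟩
      · exact ⟨⟨hz, fun hzT => hu.1.2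
          (hT z (Or.inr hzT) u (hKD hu.1.1) (hSM u hu.1.1 hu.2) huz.symm)⟩, hzM⟩
    · exact fun u hu a' ha' hua => hu.1.2
        (hT a' (Or.inl ha') u (hKD hu.1.1) (hSM u hu.1.1 hu.2) hua.symm)

/-- An infinitely edge-connected graph has a cell. -/
theorem IsInfinitelyEdgeConnected.exists_isCell (hG : G.IsInfinitelyEdgeConnected) :
    ∃ A B D : Set V, G.IsCell A B D := by
  obtain ⟨hV, hG⟩ := hG
  obtain ⟨x, y, hxy⟩ : ∃ x y, G.Adj x y := by
    obtain ⟨x⟩ := hV.to_nonempty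
    exact ⟨x, ((hG 1).preconnected one_ne_zero).exists_adj_of_nontrivial x⟩
  refine ⟨{x}, {y}, {x, y}ᶜ, Set.finite_singleton x, Set.finite_singleton y, ?_, ?_, ?_, ?_, ?_,
    ⟨x, rfl, y, rfl, hxy⟩, ?_⟩
  · exact ⟨Preconnected.of_subsingleton⟩
  · exact ⟨Preconnected.of_subsingleton⟩
  · simpa using hxy.ne
  · simp
  · simp
  · intro X hxX hXy hfin
    set F : Set (Sym2 V) := (fun e : V × V => s(e.1, e.2)) ''
      G.leavingEdges ({x} ∪ {x, y}ᶜ ∪ {y}) X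
    have hFfin : F.Finite := hfin.image _
    -- `k`-edge-connectedness allows the deletion of fewer than `k` edges, hence the `+ 1`.
    obtain ⟨p⟩ := hG (F.ncard + 1) x y (s := F) (by
      rw [← hFfin.cast_ncard_eq]
      exact_mod_cast Nat.lt_succ_self _)
    obtain ⟨d, -, hd, hd'⟩ := p.exists_boundary_dart X (hxX rfl) (Set.disjoint_right.1 hXy rfl)
    have huniv : ∀ z : V, z ∈ ({x} ∪ {x, y}ᶜ ∪ {y} : Set V) := by
      intro z
      simp only [Set.mem_union, Set.mem_compl_iff, Set.mem_insert_iff, Set.mem_singleton_iff]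
      tauto
    have hadj := d.adj
    rw [deleteEdges_adj] at hadj
    exact hadj.2 ⟨(d.fst, d.snd), ⟨hadj.1, hd, hd', huniv _, huniv _⟩, rfl⟩

end Linked

end SimpleGraph

namespace SimpleGraph

/-! ### Branch sets along the subtractive Euclidean algorithm -/

section Branch

variable {V : Type v} {G : SimpleGraph V}

/-- The cells of `G`, bundled. -/
structure Cell (G : SimpleGraph V) where
  /-- The left end. -/
  left : Set V
  /-- The right end. -/
  right : Set V
  /-- The part of the graph reserved for refining the cell. -/
  inner : Set V
  isCell : G.IsCell left right inner

/-- A division of a cell into two cells that share the end `mid`. -/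
structure Refinement (c : Cell G) where
  /-- The new branch set. -/
  mid : Set V
  /-- The inner part of the first half. -/
  inner₁ : Set V
  /-- The inner part of the second half. -/
  inner₂ : Set V
  isCell₁ : G.IsCell c.left mid inner₁
  isCell₂ : G.IsCell mid c.right inner₂
  mid_subset : mid ⊆ c.inner
  inner₁_subset : inner₁ ⊆ c.inner
  inner₂_subset : inner₂ ⊆ c.inner
  disjoint : Disjoint inner₁ inner₂

namespace Refinement

/-- The first half of a refined cell. -/
def fst {c : Cell G} (r : Refinement c) : Cell G := ⟨c.left, r.mid, r.inner₁, r.isCell₁⟩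

/-- The second half of a refined cell. -/
def snd {c : Cell G} (r : Refinement c) : Cell G := ⟨r.mid, c.right, r.inner₂, r.isCell₂⟩

end Refinement

/-- The branch set of the vector `(a, b)` in the Stern–Brocot tree of cells below `c`, found by the
subtractive Euclidean algorithm; `(1, 0)` and `(0, 1)` stand for the ends of `c`. -/
def branch (r : ∀ c : Cell G, Refinement c) (c : Cell G) (a b : ℕ) : Set V :=
  if _hb : b = 0 then c.left
  else if _ha : a = 0 then c.right
  else if b ≤ a then branch r (r c).fst (a - b) b
  else branch r (r c).snd a (b - a)
termination_by a + b

variable (r : ∀ c : Cell G, Refinement c) (c : Cell G)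

theorem branch_zero_right (a : ℕ) : branch r c a 0 = c.left := by
  rw [branch]; simp

theorem branch_zero_left {b : ℕ} (hb : b ≠ 0) : branch r c 0 b = c.right := by
  rw [branch]; simp [hb]

theorem branch_of_le {a b : ℕ} (h : b ≤ a) : branch r c a b = branch r (r c).fst (a - b) b := by
  rcases Nat.eq_zero_or_pos b with rfl | hb
  · rw [branch_zero_right, branch_zero_right]; rfl
  · rw [branch, dif_neg hb.ne', dif_neg (hb.trans_le h).ne', if_pos h]

/-- The overlap `a = b` with `branch_of_le` is consistent, as both halves share `mid`. -/
theorem branch_of_ge {a b : ℕ} (h : a ≤ b) (hb : b ≠ 0) :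
    branch r c a b = branch r (r c).snd a (b - a) := by
  rcases Nat.eq_zero_or_pos a with rfl | ha
  · rw [branch_zero_left r c hb, Nat.sub_zero, branch_zero_left r _ hb]; rfl
  · rcases h.eq_or_lt with rfl | h
    · rw [branch_of_le r c le_rfl, Nat.sub_self, branch_zero_left r _ hb, branch_zero_right]; rfl
    · rw [branch, dif_neg hb, dif_neg ha.ne', if_neg h.not_ge]

theorem branch_finite_and_connected (a b : ℕ) :
    (branch r c a b).Finite ∧ (G.induce (branch r c a b)).Connected := by
  induction hn : a + b using Nat.strong_induction_on generalizing c a b with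
  | _ n ih =>
  subst hn
  rcases Nat.eq_zero_or_pos b with rfl | hb
  · rw [branch_zero_right]; exact ⟨c.isCell.finite_left, c.isCell.connected_left⟩
  rcases Nat.eq_zero_or_pos a with rfl | ha
  · rw [branch_zero_left r c hb.ne']; exact ⟨c.isCell.finite_right, c.isCell.connected_right⟩
  rcases le_total b a with h | h
  · rw [branch_of_le r c h]; exact ih _ (by omega) _ _ _ rfl
  · rw [branch_of_ge r c h hb.ne']; exact ih _ (by omega) _ _ _ rfl

theorem branch_subset_inner {a b : ℕ} (ha : 0 < a) (hb : 0 < b) : branch r c a b ⊆ c.inner := by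
  induction hn : a + b using Nat.strong_induction_on generalizing c a b with
  | _ n ih =>
  subst hn
  rcases lt_trichotomy a b with h | rfl | h
  · rw [branch_of_ge r c h.le hb.ne']
    exact (ih _ (by omega) _ ha (by omega) rfl).trans (r c).inner₂_subset
  · rw [branch_of_le r c le_rfl, Nat.sub_self, branch_zero_left r _ hb.ne']
    exact (r c).mid_subset
  · rw [branch_of_le r c h.le]
    exact (ih _ (by omega) _ (by omega) hb rfl).trans (r c).inner₁_subset

theorem branch_fst_subset {a b : ℕ} (hb : 0 < b) :
    branch r (r c).fst a b ⊆ (r c).mid ∪ (r c).inner₁ := by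
  rcases Nat.eq_zero_or_pos a with rfl | ha
  · rw [branch_zero_left r _ hb.ne']; exact Set.subset_union_left
  · exact (branch_subset_inner r _ ha hb).trans Set.subset_union_right

/-- Vectors in the same half are handled by recursion; in different halves, `mid ∪ inner₁` is
disjoint from `inner₂`. Coprimality excludes distinct multiples of one vector, which can share a
branch set. -/
theorem disjoint_branch {a b a' b' : ℕ} (h : a.Coprime b) (h' : a'.Coprime b')
    (hne : (a, b) ≠ (a', b')) : Disjoint (branch r c a b) (branch r c a' b') := by
  induction hn : a + b + a' + b' using Nat.strong_induction_on generalizing c a b a' b' with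
  | _ n ih =>
  subst hn
  wlog hle : b * a' ≤ a * b' generalizing a b a' b'
  · exact (this h' h hne.symm (fun m hm c _ _ _ _ => ih m (by omega) c) (by nlinarith)).symm
  rcases Nat.eq_zero_or_pos b with rfl | hb
  · obtain rfl : a = 1 := by simpa using h
    have hb' : 0 < b' := by
      rcases Nat.eq_zero_or_pos b' with rfl | hb'
      · obtain rfl : a' = 1 := by simpa using h'
        exact absurd rfl hne
      · exact hb'
    rw [branch_zero_right]
    rcases Nat.eq_zero_or_pos a' with rfl | ha'
    · rw [branch_zero_left r c hb'.ne']; exact c.isCell.disjoint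
    · exact c.isCell.disjoint_left.mono_right (branch_subset_inner r c ha' hb')
  rcases Nat.eq_zero_or_pos a' with rfl | ha'
  · obtain rfl : b' = 1 := by simpa using h'
    rw [branch_zero_left r c one_ne_zero]
    rcases Nat.eq_zero_or_pos a with rfl | ha
    · obtain rfl : b = 1 := by simpa using h
      exact absurd rfl hne
    · exact (c.isCell.disjoint_right.mono_right (branch_subset_inner r c ha hb)).symm
  have ha : 0 < a := by
    by_contra h0
    obtain rfl : a = 0 := by omega
    have := Nat.mul_pos hb ha'
    omega
  have hb' : 0 < b' := by
    by_contra h0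
    obtain rfl : b' = 0 := by omega
    have := Nat.mul_pos hb ha'
    omega
  have co : ∀ {x y : ℕ}, x.Coprime y → y ≤ x → (x - y).Coprime y := fun hxy hle =>
    (Nat.coprime_sub_self_left hle).2 hxy
  have co' : ∀ {x y : ℕ}, x.Coprime y → x ≤ y → x.Coprime (y - x) := fun hxy hle =>
    (Nat.coprime_sub_self_right hle).2 hxy
  rcases le_or_gt b a with h1 | h1 <;> rcases le_or_gt b' a' with h2 | h2
  · rw [branch_of_le r c h1, branch_of_le r c h2]
    refine ih _ (by omega) _ (co h h1) (co h' h2) (fun heq => hne ?_) rfl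
    simp only [Prod.mk.injEq] at heq ⊢
    omega
  · rw [branch_of_le r c h1, branch_of_ge r c h2.le hb'.ne']
    refine Disjoint.mono (branch_fst_subset r c hb) (branch_subset_inner r _ ha' (by omega)) ?_
    exact Set.disjoint_union_left.2 ⟨(r c).isCell₂.disjoint_left, (r c).disjoint⟩
  · nlinarith
  · rw [branch_of_ge r c h1.le hb.ne', branch_of_ge r c h2.le hb'.ne']
    refine ih _ (by omega) _ (co' h h1.le) (co' h' h2.le) (fun heq => hne ?_) rfl
    simp only [Prod.mk.injEq] at heq ⊢
    omega

/-- Subtraction preserves the determinant `1`, and such a pair never lies strictly on opposite sides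
of the middle unless it is the pair of ends. -/
theorem branch_adj {a b a' b' : ℕ} (h : a * b' = b * a' + 1) :
    ∃ x ∈ branch r c a b, ∃ y ∈ branch r c a' b', G.Adj x y := by
  induction hn : a + b + a' + b' using Nat.strong_induction_on generalizing c a b a' b' with
  | _ n ih =>
  subst hn
  have ha : 0 < a := Nat.pos_of_ne_zero (by rintro rfl; omega)
  have hb' : 0 < b' := Nat.pos_of_ne_zero (by rintro rfl; omega)
  rcases le_or_gt b a with h1 | h1 <;> rcases le_or_gt b' a' with h2 | h2
  · rw [branch_of_le r c h1, branch_of_le r c h2]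
    refine ih _ (by omega) _ ?_ rfl
    obtain ⟨k, rfl⟩ := Nat.exists_eq_add_of_le h1
    obtain ⟨l, rfl⟩ := Nat.exists_eq_add_of_le h2
    simp only [Nat.add_sub_cancel_left]
    nlinarith
  · rcases Nat.eq_zero_or_pos b with rfl | hb
    · obtain ⟨rfl, rfl⟩ : a = 1 ∧ b' = 1 := by simpa using h
      obtain rfl : a' = 0 := by omega
      rw [branch_zero_right, branch_zero_left r c one_ne_zero]
      exact c.isCell.adj
    -- A vector on the diagonal stands for the middle, so it may be treated as the left end of the
    -- second half.
    · rcases h1.eq_or_lt with rfl | h1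
      · rw [branch_of_ge r c le_rfl ha.ne', branch_of_ge r c h2.le hb'.ne']
        refine ih _ (by omega) _ ?_ rfl
        obtain ⟨l, rfl⟩ := Nat.exists_eq_add_of_le h2.le
        simp only [Nat.add_sub_cancel_left, Nat.sub_self]
        nlinarith
      · exfalso
        nlinarith [Nat.mul_le_mul h1 h2]
  · exfalso
    nlinarith [Nat.mul_le_mul h1.le h2]
  · rw [branch_of_ge r c h1.le (by omega), branch_of_ge r c h2.le hb'.ne']
    refine ih _ (by omega) _ ?_ rfl
    obtain ⟨k, rfl⟩ := Nat.exists_eq_add_of_le h1.le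
    obtain ⟨l, rfl⟩ := Nat.exists_eq_add_of_le h2.le
    simp only [Nat.add_sub_cancel_left]
    nlinarith

end Branch

end SimpleGraph

/-! ### The Farey graph as a tight minor of a Π-graph -/

section FareyMinor

variable {V : Type v} {G : SimpleGraph V}

namespace SimpleGraph

/-- The branch sets of a Farey graph minor below the cell `c`: the ends of `c` form the branch set
of `∞`, while `0` is assigned to the middle of `c` and the positive and negative rationals are
assigned to the two halves of `c`. -/
def fareyBranch (r : ∀ c : Cell G, Refinement c) (c : Cell G) : OnePoint ℚ → Set V
  | none => c.left ∪ c.right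
  | some q => branch r c (q.den + q.num.toNat) (q.den + (-q.num).toNat)

theorem coprime_den_add_toNat (q : ℚ) :
    (q.den + q.num.toNat).Coprime (q.den + (-q.num).toNat) := by
  have h := q.reduced
  obtain ⟨k, hk | hk⟩ := q.num.eq_nat_or_neg
  · rw [hk, Int.natAbs_natCast] at h
    simpa [hk] using h
  · rw [hk, Int.natAbs_neg, Int.natAbs_natCast] at h
    simpa [hk] using h.symm

theorem disjoint_fareyBranch (r : ∀ c : Cell G, Refinement c) (c : Cell G) {x y : OnePoint ℚ}
    (hxy : x ≠ y) : Disjoint (fareyBranch r c x) (fareyBranch r c y) := by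
  have key : ∀ q : ℚ, Disjoint (c.left ∪ c.right)
      (branch r c (q.den + q.num.toNat) (q.den + (-q.num).toNat)) := fun q =>
    (Set.disjoint_union_left.2 ⟨c.isCell.disjoint_left, c.isCell.disjoint_right⟩).mono_right
      (branch_subset_inner r c (Nat.add_pos_left q.den_pos _) (Nat.add_pos_left q.den_pos _))
  rcases x with _ | p <;> rcases y with _ | q
  · exact absurd rfl hxy
  · exact key q
  · exact (key p).symm
  · refine disjoint_branch r c (coprime_den_add_toNat p) (coprime_den_add_toNat q) fun h => ?_
    refine hxy (congrArg some (Rat.ext ?_ ?_)) <;>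
    · simp only [Prod.mk.injEq] at h
      omega

/-- The coordinates of `fareyBranch` are a shear on each sign of the numerator, so determinants
survive within a half. Non-negative integers become neighbours of `(1, 0)` and non-positive ones of
`(0, 1)`; both ends belong to `∞`. -/
theorem fareyBranch_adj_of_det (r : ∀ c : Cell G, Refinement c) (c : Cell G) {x y : OnePoint ℚ}
    (h : fareyNum x * fareyDen y - fareyNum y * fareyDen x = 1) :
    ∃ v ∈ fareyBranch r c x, ∃ w ∈ fareyBranch r c y, G.Adj v w := by
  rcases x with _ | p <;> rcases y with _ | q <;> simp only [fareyNum, fareyDen, fareyBranch] at h ⊢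
  · omega
  · have hd : q.den = 1 := by omega
    rw [hd]
    obtain ⟨k, hk | hk⟩ := q.num.eq_nat_or_neg
    · obtain ⟨v, hv, w, hw, hvw⟩ := branch_adj r c (a := 1) (b := 0) (a' := 1 + k) (b' := 1)
        (by omega)
      rw [branch_zero_right] at hv
      exact ⟨v, Or.inl hv, w, by simpa [hk] using hw, hvw⟩
    · obtain ⟨v, hv, w, hw, hvw⟩ := branch_adj r c (a := 1) (b := 1 + k) (a' := 0) (b' := 1)
        (by omega)
      rw [branch_zero_left r c one_ne_zero] at hw
      exact ⟨w, Or.inr hw, v, by simpa [hk] using hv, hvw.symm⟩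
  · have := p.den_pos
    omega
  · have hp := p.den_pos
    have hq := q.den_pos
    apply branch_adj
    obtain ⟨k, hk | hk⟩ := p.num.eq_nat_or_neg <;> obtain ⟨l, hl | hl⟩ := q.num.eq_nat_or_neg <;>
      rw [hk, hl] at h <;> rw [hk, hl] <;> zify at hp hq ⊢ <;> simp
    · linarith
    -- For opposite signs the determinant is `k * q.den + l * p.den`, so the value `1` forces `k =
    -- 0` or `l = 0` and the extra term `k * l` vanishes.
    · rcases Nat.eq_zero_or_pos k with rfl | hk0
      · push_cast at *; linarith
      rcases Nat.eq_zero_or_pos l with rfl | hl0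
      · push_cast at *; linarith
      zify at hk0 hl0
      nlinarith
    · nlinarith
    · linarith

/-- The Farey graph is a tight minor of every Π-graph. -/
theorem IsPiGraph.isTightMinor_fareyGraph (hG : G.IsPiGraph) : IsTightMinor fareyGraph G := by
  obtain ⟨A, B, D, hc⟩ := hG.1.exists_isCell
  have r : ∀ c : Cell G, Refinement c := fun c => Classical.choice (by
    obtain ⟨M, D₁, D₂, h₁, h₂, h₃, h₄, h₅, h₆⟩ := c.isCell.exists_refinement hG.2
    exact ⟨⟨M, D₁, D₂, h₁, h₂, h₃, h₄, h₅, h₆⟩⟩)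
  let c : Cell G := ⟨A, B, D, hc⟩
  refine ⟨fareyBranch r c, ⟨?_, fun x y => disjoint_fareyBranch r c, ?_⟩, ?_⟩
  · rintro (_ | q)
    · obtain ⟨v, hv, w, hw, hvw⟩ := hc.adj
      exact connected_induce_union hc.connected_left.preconnected hc.connected_right.preconnected
        hv hw hvw
    · exact (branch_finite_and_connected r c _ _).2
  · intro x y hxy
    simp only [fareyGraph, Matrix.det_fin_two_of] at hxy
    rcases hxy with h | h
    · exact fareyBranch_adj_of_det r c h
    · obtain ⟨v, hv, w, hw, hvw⟩ := fareyBranch_adj_of_det r c (x := y) (y := x) (by linarith)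
      exact ⟨w, hw, v, hv, hvw.symm⟩
  · rintro (_ | q)
    · exact hc.finite_left.union hc.finite_right
    · exact (branch_finite_and_connected r c _ _).1

end SimpleGraph

end FareyMinor

/-! ### Determinants, connectivity and sides of edges in the Farey graph -/

section Farey

/-- The determinant of the matrix whose columns are the vectors of two vertices of the Farey
graph. -/
def fareyDet (x y : OnePoint ℚ) : ℤ := fareyNum x * fareyDen y - fareyNum y * fareyDen x

theorem fareyGraph_adj {x y : OnePoint ℚ} :
    fareyGraph.Adj x y ↔ fareyDet x y = 1 ∨ fareyDet x y = -1 := by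
  simp [fareyGraph, fareyDet, Matrix.det_fin_two_of]

theorem fareyDen_nonneg (x : OnePoint ℚ) : 0 ≤ fareyDen x := by
  rcases x with _ | q
  · exact le_rfl
  · exact Int.natCast_nonneg _

theorem isCoprime_fareyNum_fareyDen (x : OnePoint ℚ) : IsCoprime (fareyNum x) (fareyDen x) := by
  rcases x with _ | q
  · exact isCoprime_one_left
  · exact Rat.isCoprime_num_den q

theorem eq_of_fareyDet_eq_zero {x y : OnePoint ℚ} (h : fareyDet x y = 0) : x = y := by
  rcases x with _ | p <;> rcases y with _ | q <;> simp only [fareyDet, fareyNum, fareyDen] at h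
  · rfl
  · have := q.den_pos
    omega
  · have := p.den_pos
    omega
  · exact congrArg some (Rat.eq_iff_mul_eq_mul.2 (by linarith))

theorem fareyDet_self (x : OnePoint ℚ) : fareyDet x x = 0 := sub_self _

/-- The sign `ε` normalises the denominator to be non-negative. -/
theorem exists_fareyNum_fareyDen_eq {a b : ℤ} (h : IsCoprime a b) :
    ∃ x : OnePoint ℚ, ∃ ε : ℤ, (ε = 1 ∨ ε = -1) ∧ fareyNum x = ε * a ∧ fareyDen x = ε * b := by
  have pos : ∀ {a b : ℤ}, 0 < b → IsCoprime a b →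
      ∃ x : OnePoint ℚ, fareyNum x = a ∧ fareyDen x = b := by
    intro a b hb h
    have h' := Int.isCoprime_iff_gcd_eq_one.1 h
    exact ⟨some ((a : ℚ) / b), Rat.num_div_eq_of_coprime hb h',
      Rat.den_div_eq_of_coprime hb h'⟩
  rcases lt_trichotomy b 0 with hb | rfl | hb
  · obtain ⟨x, hx, hx'⟩ := pos (neg_pos.2 hb) h.neg_neg
    exact ⟨x, -1, Or.inr rfl, by simpa using hx, by simpa using hx'⟩
  · rcases Int.isUnit_iff.1 (isCoprime_zero_right.1 h) with rfl | rfl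
    · exact ⟨none, 1, Or.inl rfl, rfl, rfl⟩
    · exact ⟨none, -1, Or.inr rfl, rfl, rfl⟩
  · obtain ⟨x, hx, hx'⟩ := pos hb h
    exact ⟨x, 1, Or.inl rfl, by simpa using hx, by simpa using hx'⟩

/-- The height of a vertex of the Farey graph. -/
def fareyHeight (x : OnePoint ℚ) : ℤ := |fareyNum x| + fareyDen x

theorem fareyHeight_pos (x : OnePoint ℚ) : 0 < fareyHeight x := by
  rcases x with _ | q
  · simp [fareyHeight, fareyNum, fareyDen]
  · have := q.den_pos
    have := abs_nonneg q.num
    simp only [fareyHeight, fareyNum, fareyDen]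
    omega

/-- The two ends of an edge of the Farey graph have a common neighbour of larger height. -/
theorem exists_mediant {x y : OnePoint ℚ} (h : fareyGraph.Adj x y) :
    ∃ m, fareyGraph.Adj x m ∧ fareyGraph.Adj m y ∧
      fareyHeight m = fareyHeight x + fareyHeight y := by
  have hb := fareyDen_nonneg x
  have hd := fareyDen_nonneg y
  rw [fareyGraph_adj, fareyDet] at h
  obtain ⟨σ, hσ, hnum, hden⟩ : ∃ σ : ℤ, (σ = 1 ∨ σ = -1) ∧
      |fareyNum x + σ * fareyNum y| = |fareyNum x| + |fareyNum y| ∧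
      |fareyDen x + σ * fareyDen y| = fareyDen x + fareyDen y := by
    generalize fareyNum x = a at *
    generalize fareyNum y = c at *
    generalize fareyDen x = b at *
    generalize fareyDen y = d at *
    by_cases hac : 0 ≤ a * c
    · refine ⟨1, Or.inl rfl, ?_, ?_⟩
      · rw [one_mul, abs_add_eq_add_abs_iff]
        rcases mul_nonneg_iff.1 hac with h | h
        · exact Or.inl h
        · exact Or.inr h
      · rw [one_mul, abs_of_nonneg (add_nonneg hb hd)]
    · rw [not_le, mul_neg_iff] at hac
      refine ⟨-1, Or.inr rfl, ?_, ?_⟩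
      · have : |a + -1 * c| = |a + -c| := by ring_nf
        rw [this, ← abs_neg c, abs_add_eq_add_abs_iff]
        rcases hac with h | h
        · exact Or.inl ⟨h.1.le, by linarith [h.2]⟩
        · exact Or.inr ⟨h.1.le, by linarith [h.2]⟩
      -- Numerators of opposite sign over two positive denominators would give a determinant of
      -- absolute value at least `2`.
      · have hbd : b = 0 ∨ d = 0 := by
          by_contra! hne
          have hb' : 1 ≤ b := by omega
          have hd' : 1 ≤ d := by omega
          rcases hac with ⟨h1, h2⟩ | ⟨h1, h2⟩
          · have : 1 ≤ a * d := by nlinarith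
            have : 1 ≤ -c * b := by nlinarith
            rcases h with h | h <;> linarith
          · have : 1 ≤ -a * d := by nlinarith
            have : 1 ≤ c * b := by nlinarith
            rcases h with h | h <;> linarith
        rcases hbd with rfl | rfl
        · simp [abs_of_nonneg hd]
        · simp [abs_of_nonneg hb]
  have hco : IsCoprime (fareyNum x + σ * fareyNum y) (fareyDen x + σ * fareyDen y) := by
    rcases h with h | h
    · exact ⟨fareyDen y, -fareyNum y, by linear_combination h⟩
    · exact ⟨-fareyDen y, fareyNum y, by linear_combination -h⟩
  obtain ⟨m, ε, hε, hm, hm'⟩ := exists_fareyNum_fareyDen_eq hco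
  have hm0 := fareyDen_nonneg m
  refine ⟨m, ?_, ?_, ?_⟩
  · rw [fareyGraph_adj, fareyDet, hm, hm']
    rcases hε with rfl | rfl <;> rcases hσ with rfl | rfl <;> rcases h with h | h <;>
      first | (left; linear_combination h) | (right; linear_combination h) |
        (left; linear_combination -h) | (right; linear_combination -h)
  · rw [fareyGraph_adj, fareyDet, hm, hm']
    rcases hε with rfl | rfl <;> rcases h with h | h <;>
      first | (left; linear_combination h) | (right; linear_combination h) |
        (left; linear_combination -h) | (right; linear_combination -h)
  · have hε' : |ε| = 1 := by rcases hε with rfl | rfl <;> simp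
    rw [fareyHeight, ← abs_of_nonneg hm0, hm, hm', abs_mul, abs_mul, hε', hnum, hden, fareyHeight,
      fareyHeight]
    ring

/-- Descent on the denominator: a Bézout coefficient reduced modulo `fareyDen x` gives a neighbour
of smaller denominator. -/
theorem fareyGraph_preconnected : fareyGraph.Preconnected := by
  have key : ∀ n : ℕ, ∀ x : OnePoint ℚ, fareyDen x = n → fareyGraph.Reachable x none := by
    intro n
    induction n using Nat.strong_induction_on with
    | _ n ih =>
    intro x hx
    rcases Nat.eq_zero_or_pos n with rfl | hn
    · have h0 : fareyDen none = 0 := rfl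
      rw [eq_of_fareyDet_eq_zero (x := x) (y := none) (by simp [fareyDet, hx, h0])]
      exact SimpleGraph.Reachable.refl _
    · obtain ⟨s, t, hst⟩ := isCoprime_fareyNum_fareyDen x
      have hdiv := Int.emod_add_mul_ediv s (fareyDen x)
      have h0 := Int.emod_nonneg s (b := fareyDen x) (by omega)
      have hlt := Int.emod_lt_of_pos s (b := fareyDen x) (by omega)
      have hdet : fareyNum x * (s % fareyDen x) -
          (-t - fareyNum x * (s / fareyDen x)) * fareyDen x = 1 := by
        linear_combination fareyNum x * hdiv + hst
      obtain ⟨m, ε, hε, hm, hm'⟩ := exists_fareyNum_fareyDen_eq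
        (a := -t - fareyNum x * (s / fareyDen x)) (b := s % fareyDen x)
        ⟨-fareyDen x, fareyNum x, by linear_combination hdet⟩
      have hadj : fareyGraph.Adj x m := by
        rw [fareyGraph_adj, fareyDet, hm, hm']
        rcases hε with rfl | rfl
        · left; linear_combination hdet
        · right; linear_combination -hdet
      have hm0 := fareyDen_nonneg m
      refine hadj.reachable.trans (ih (fareyDen m).toNat ?_ m (Int.toNat_of_nonneg hm0).symm)
      rcases hε with rfl | rfl <;> omega
  intro x y
  exact (key _ x (Int.toNat_of_nonneg (fareyDen_nonneg x)).symm).trans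
    (key _ y (Int.toNat_of_nonneg (fareyDen_nonneg y)).symm).symm

/-- Replacing an edge by the two edges through its mediant raises the height sum by at least `1`.
After finitely many rounds all edges are higher than those in `F`, so the ends of every edge stay
connected. -/
theorem fareyGraph_isInfinitelyEdgeConnected : fareyGraph.IsInfinitelyEdgeConnected := by
  refine ⟨inferInstance, fun k x y F hF => ?_⟩
  have hFfin : F.Finite := Set.finite_of_encard_le_coe hF.le
  let height : Sym2 (OnePoint ℚ) → ℤ :=
    Sym2.lift ⟨fun x y => fareyHeight x + fareyHeight y, fun x y => add_comm _ _⟩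
  obtain ⟨N, hN⟩ := (hFfin.image height).bddAbove
  have key : ∀ n : ℕ, ∀ x y, fareyGraph.Adj x y → N < fareyHeight x + fareyHeight y + n →
      (fareyGraph.deleteEdges F).Reachable x y := by
    intro n
    induction n with
    | zero =>
      intro x y hxy hlt
      refine SimpleGraph.Adj.reachable ?_
      rw [SimpleGraph.deleteEdges_adj]
      refine ⟨hxy, fun hmem => ?_⟩
      have : fareyHeight x + fareyHeight y ≤ N := hN ⟨_, hmem, rfl⟩
      push_cast at hlt
      linarith
    | succ n ih =>
      intro x y hxy hlt
      obtain ⟨m, hxm, hmy, hm⟩ := exists_mediant hxy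
      have hx := fareyHeight_pos x
      have hy := fareyHeight_pos y
      push_cast at hlt
      exact (ih x m hxm (by linarith)).trans (ih m y hmy (by linarith))
  obtain ⟨p⟩ := fareyGraph_preconnected x y
  induction p with
  | nil => rfl
  | @cons u v w huv p ih =>
    exact (key (N - (fareyHeight u + fareyHeight v) + 1).toNat u v huv (by omega)).trans ih

/-- The product of the determinants of `z` with `x` and with `m`. If `x` and `m` are adjacent, then
its sign tells on which side of the edge `xm` the vertex `z` lies. -/
def fareySide (x m z : OnePoint ℚ) : ℤ := fareyDet x z * fareyDet m z

/-- By the Plücker identity `±1` is a difference of two integers whose product is the product of the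
sides. Integers of opposite sign differ by at least `2`. -/
theorem fareySide_mul_pos_of_adj {x m u v : OnePoint ℚ} (hxm : fareyGraph.Adj x m)
    (huv : fareyGraph.Adj u v) (hu : fareySide x m u ≠ 0) (hv : fareySide x m v ≠ 0) :
    0 < fareySide x m u * fareySide x m v := by
  refine lt_of_le_of_ne (le_of_not_gt fun hneg => ?_) (mul_ne_zero hu hv).symm
  rw [fareyGraph_adj] at hxm huv
  have plucker : fareyDet x m * fareyDet u v =
      fareyDet x u * fareyDet m v - fareyDet x v * fareyDet m u := by
    simp only [fareyDet]; ring
  have hprod : (fareyDet x u * fareyDet m v) * (fareyDet x v * fareyDet m u) < 0 := by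
    simp only [fareySide] at hneg
    linarith
  have hone : fareyDet x m * fareyDet u v = 1 ∨ fareyDet x m * fareyDet u v = -1 := by
    rcases hxm with h | h <;> rcases huv with h' | h' <;> rw [h, h'] <;> simp
  rw [plucker] at hone
  rcases mul_neg_iff.1 hprod with ⟨h1, h2⟩ | ⟨h1, h2⟩ <;> omega

theorem fareySide_mul_pos_of_walk {x m : OnePoint ℚ} (hxm : fareyGraph.Adj x m)
    {u v : OnePoint ℚ} (p : fareyGraph.Walk u v) (hp : ∀ z ∈ p.support, fareySide x m z ≠ 0) :
    0 < fareySide x m u * fareySide x m v := by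
  induction p with
  | @nil u => exact mul_self_pos.2 (hp u (by simp))
  | @cons u v w huv p ih =>
    have h1 := ih fun z hz => hp z (by simp [hz])
    have h2 := fareySide_mul_pos_of_adj hxm huv (hp u (by simp)) (hp v (by simp))
    by_contra hneg
    nlinarith [mul_self_pos.2 (hp v (by simp)), mul_pos h1 h2]

/-- A walk that avoids `x` and connects the two sides of an edge `xm` contains `m`. -/
theorem mem_support_of_fareySide_mul_neg {x m u v : OnePoint ℚ} (hxm : fareyGraph.Adj x m)
    (p : fareyGraph.Walk u v) (hx : x ∉ p.support)
    (h : fareySide x m u * fareySide x m v < 0) : m ∈ p.support := by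
  by_contra hm
  refine absurd h (fareySide_mul_pos_of_walk hxm p fun z hz h0 => ?_).not_gt
  rcases mul_eq_zero.1 h0 with h0 | h0
  · exact hx (eq_of_fareyDet_eq_zero h0 ▸ hz)
  · exact hm (eq_of_fareyDet_eq_zero h0 ▸ hz)

end Farey

/-! ### Finite separators in the Farey graph -/

section FareyPi

/-- Any two vertices of the Farey graph are separated by finitely many vertices, up to a direct
edge between them. -/
theorem exists_finite_fareyGraph_separator {x y : OnePoint ℚ} (hxy : x ≠ y) :
    ∃ S : Set (OnePoint ℚ), S.Finite ∧ ∀ p : fareyGraph.Path x y,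
      p.1.support ≠ [x, y] → ∃ z ∈ S, z ∈ p.1.support ∧ z ≠ x ∧ z ≠ y := by
  obtain ⟨s, t, hst⟩ := isCoprime_fareyNum_fareyDen x
  -- In coordinates that move `x` to `∞`, the vertex `m i` is the integer `i`, and `z ≠ x` has
  -- coordinate `α z / fareyDet x z`.
  have hm : ∀ i : ℤ, ∃ m : OnePoint ℚ, ∃ ε : ℤ, (ε = 1 ∨ ε = -1) ∧
      fareyNum m = ε * (-t + i * fareyNum x) ∧ fareyDen m = ε * (s + i * fareyDen x) := fun i =>
    exists_fareyNum_fareyDen_eq ⟨-fareyDen x, fareyNum x, by linear_combination hst⟩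
  choose m ε hε hnum hden using hm
  set α : OnePoint ℚ → ℤ := fun z => fareyNum z * s + t * fareyDen z with hα
  have hxm : ∀ i, fareyGraph.Adj x (m i) := by
    intro i
    have : fareyDet x (m i) = ε i := by
      rw [fareyDet, hnum, hden]
      linear_combination ε i * hst
    rw [fareyGraph_adj, this]
    exact hε i
  have hmz : ∀ i z, fareyDet (m i) z = ε i * (i * fareyDet x z - α z) := by
    intro i z
    rw [fareyDet, hnum, hden, hα, fareyDet]
    ring
  have hεε : ∀ i, ε i * ε i = 1 := fun i => by rcases hε i with h | h <;> rw [h] <;> rfl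
  have hβ : fareyDet x y ≠ 0 := fun h => hxy (eq_of_fareyDet_eq_zero h)
  set β := fareyDet x y with hβ_def
  have hββ : 0 < β * β := mul_self_pos.2 hβ
  set k : ℤ := (α y * β) / (β * β) with hk
  have hk₁ := Int.emod_add_mul_ediv (α y * β) (β * β)
  have hk₂ := Int.emod_nonneg (α y * β) hββ.ne'
  have hk₃ := Int.emod_lt_of_pos (α y * β) hββ
  rw [← hk] at hk₁
  have hyk₁ : 0 < (k + 1) * (β * β) - α y * β := by linarith
  have hyk₂ : (k - 1) * (β * β) - α y * β < 0 := by linarith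
  refine ⟨{m (k - 1), m k, m (k + 1)}, by simp, ?_⟩
  rintro ⟨p, hp⟩ hne
  cases p with
  | nil => exact absurd rfl hxy
  | @cons _ u _ hxu p =>
  rw [SimpleGraph.Walk.cons_isPath_iff] at hp
  have hux : u ≠ x := hxu.ne.symm
  have huy : u ≠ y := by
    rintro rfl
    have := (SimpleGraph.Walk.isPath_iff_nil.1 hp.1).eq_nil
    subst this
    exact hne rfl
  have hδ := fareyGraph_adj.1 hxu
  set δ := fareyDet x u with hδ_def
  have hδδ : δ * δ = 1 := by rcases hδ with h | h <;> rw [h] <;> rfl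
  -- The sign is negative exactly when `i` lies strictly between the coordinates of `u` and `y`;
  -- then the edge from `x` to `m i` separates them.
  have hside : ∀ i, fareySide x (m i) u * fareySide x (m i) y =
      (i - δ * α u) * (i * (β * β) - α y * β) := by
    intro i
    rw [fareySide, fareySide, hmz, hmz, ← hβ_def, ← hδ_def]
    linear_combination (i * β * β - α y * β) * (i * (δ * δ) - δ * α u) * hεε i +
      (i * β * β - α y * β) * i * hδδ
  have hsupp : ∀ i, (i - δ * α u) * (i * (β * β) - α y * β) < 0 →
      ∃ z, z = m i ∧ z ∈ (SimpleGraph.Walk.cons hxu p).support ∧ z ≠ x ∧ z ≠ y := by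
    intro i hi
    have hmem := mem_support_of_fareySide_mul_neg (hxm i) p hp.2 ((hside i).trans_lt hi)
    refine ⟨m i, rfl, by simp [hmem], (hxm i).ne.symm, ?_⟩
    rintro rfl
    rw [← hside, fareySide, fareySide, fareyDet_self] at hi
    simp at hi
  rcases lt_or_ge (k + 1) (δ * α u) with hlt | hge
  · obtain ⟨z, rfl, hz⟩ := hsupp (k + 1) (mul_neg_of_neg_of_pos (by linarith) hyk₁)
    exact ⟨_, by simp, hz⟩
  rcases lt_or_ge (δ * α u) (k - 1) with hlt | hge'
  · obtain ⟨z, rfl, hz⟩ := hsupp (k - 1) (mul_neg_of_pos_of_neg (by linarith) hyk₂)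
    exact ⟨_, by simp, hz⟩
  refine ⟨u, ?_, by simp, hux, huy⟩
  have hu : u = m (δ * α u) := by
    refine (eq_of_fareyDet_eq_zero ?_).symm
    rw [hmz, ← hδ_def]
    linear_combination ε (δ * α u) * α u * hδδ
  have hcases : δ * α u = k - 1 ∨ δ * α u = k ∨ δ * α u = k + 1 := by omega
  rcases hcases with h | h | h <;> rw [h] at hu <;> simp [hu]

/-- Pigeonhole: among infinitely many indirect paths, two meet the finite separator in the same
inner vertex. -/
theorem fareyGraph_isPiGraph : fareyGraph.IsPiGraph := by
  refine ⟨fareyGraph_isInfinitelyEdgeConnected, fun x y hxy => ?_⟩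
  rintro ⟨P, hP, hind⟩
  obtain ⟨S, hS, hsep⟩ := exists_finite_fareyGraph_separator hxy
  have hdirect : {p : fareyGraph.Path x y | p.1.support = [x, y]}.Finite :=
    Set.Subsingleton.finite fun p hp q hq =>
      Subtype.ext (SimpleGraph.Walk.ext_support (hp.trans hq.symm))
  choose! f hfS hfp hfx hfy using hsep
  obtain ⟨p, hp, q, hq, hne, heq⟩ := (hP.sdiff hdirect).exists_ne_map_eq_of_mapsTo
    (f := f) (t := S) (fun p hp => hfS p hp.2) hS
  rcases hind hp.1 hq.1 hne (f p) (hfp p hp.2) (heq ▸ hfp q hq.2) with h | h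
  · exact hfx p hp.2 h
  · exact hfy p hp.2 h

end FareyPi

namespace SimpleGraph

/-! ### Transfer along isomorphisms -/

section Transfer

variable {V : Type v} {W : Type w} {G : SimpleGraph V} {H : SimpleGraph W}

theorem IsPiGraph.of_iso (e : G ≃g H) (hG : G.IsPiGraph) : H.IsPiGraph := by
  obtain ⟨⟨hV, hconn⟩, hpath⟩ := hG
  refine ⟨⟨e.symm.toEquiv.nontrivial, fun k x y F hF => ?_⟩, fun x y hxy => ?_⟩
  · let f : G.deleteEdges (Sym2.map e ⁻¹' F) →g H.deleteEdges F :=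
      { toFun := e
        map_rel' := by
          intro a b hab
          rw [deleteEdges_adj] at hab ⊢
          exact ⟨e.map_adj_iff.2 hab.1, hab.2⟩ }
    have hle : (Sym2.map e ⁻¹' F).encard ≤ F.encard := by
      rw [← (Sym2.map.injective e.injective).encard_image]
      exact Set.encard_le_encard (Set.image_preimage_subset _ _)
    have := (hconn k (e.symm x) (e.symm y) (hle.trans_lt hF)).map f
    simpa [f] using this
  · rintro ⟨P, hP, hind⟩
    let f : H →g G := e.symm.toHom
    have hf : Function.Injective f := e.symm.injective
    refine hpath (e.symm x) (e.symm y) (fun h => hxy (e.symm.injective h))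
      ⟨(fun p : H.Path x y => p.map f hf) '' P,
        hP.image (Path.map_injective hf x y).injOn, ?_⟩
    rintro _ ⟨p, hp, rfl⟩ _ ⟨q, hq, rfl⟩ hne z hz hz'
    simp only [Path.map_coe, Walk.support_map, List.mem_map] at hz hz'
    obtain ⟨a, ha, rfl⟩ := hz
    obtain ⟨b, hb, hba⟩ := hz'
    obtain rfl := hf hba
    exact (hind hp hq (fun h => hne (h ▸ rfl)) b ha hb).imp (congrArg f) (congrArg f)

theorem IsTightMinor.trans_iso {U : Type u} {K : SimpleGraph U} (e : G ≃g H)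
    (h : IsTightMinor K G) : IsTightMinor K H := by
  obtain ⟨B, ⟨hconn, hdisj, hadj⟩, hfin⟩ := h
  refine ⟨fun a => e '' B a, ⟨fun a => ?_, fun a b hab => ?_, fun a b hab => ?_⟩,
    fun a => (hfin a).image e⟩
  · let f : G.induce (B a) ≃g H.induce (e '' B a) :=
      { toEquiv := e.toEquiv.image (B a)
        map_rel_iff' := e.map_adj_iff }
    exact f.connected_iff.1 (hconn a)
  · exact (Set.disjoint_image_iff e.injective).2 (hdisj a b hab)
  · obtain ⟨x, hx, y, hy, hxy⟩ := hadj a b hab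
    exact ⟨e x, ⟨x, hx, rfl⟩, e y, ⟨y, hy, rfl⟩, e.map_adj_iff.2 hxy⟩

end Transfer

end SimpleGraph

theorem theorem3p2 :
    SimpleGraph.IsTightlyTypical.{u} fareyGraph ∧
      ∀ (V : Type v) (G : SimpleGraph V), SimpleGraph.IsTightlyTypical.{u} G →
        SimpleGraph.TightlyMinorEquivalent G fareyGraph := by
  refine ⟨⟨fareyGraph_isPiGraph, fun _ _ h => h.isTightMinor_fareyGraph⟩, fun V G hG => ?_⟩
  -- Typicality of `G` concerns Π-graphs in universe `u`, so it is applied to a lifted copy of the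
  -- Farey graph.
  let e : fareyGraph.comap (Equiv.ulift.{u} : ULift (OnePoint ℚ) ≃ OnePoint ℚ) ≃g fareyGraph :=
    SimpleGraph.Iso.comap Equiv.ulift fareyGraph
  exact ⟨(hG.2 _ _ (fareyGraph_isPiGraph.of_iso e.symm)).trans_iso e, hG.1.isTightMinor_fareyGraph⟩
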